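/- Let $n\ge 0$ and let $c_1,\dots,c_{2n}$ be the Majorana operators on $(\mathbb C^2)^{\otimes n}$, $$c_{2j-1}=Z^{\otimes (j-1)}\otimes X\otimes I^{\otimes (n-j)},\qquad c_{2j}=Z^{\otimes (j-1)}\otimes Y\otimes I^{\otimes (n-j)}\qquad(1\le j\le n),$$ with $X,Y,Z$ the Pauli matrices. Let $G=\mathbb Z_2^{2n}$ carry the unnormalized fermionic 2-cocycle $\sigma_{\rm fer}(x,y)=(-1)^{x^T\Delta y}$, where $\Delta$ is the $2n\times 2n$ matrix with entries $1$ strictly below the diagonal and $0$ elsewhere, and put $\Phi(x)(y)=\sigma_{\rm fer}(x,y)\overline{\sigma_{\rm fer}(y,x)}$ and $W(x)=c_1^{x_1}\cdots c_{2n}^{x_{2n}}$ for $x,y\in G$. For a $2^n\times 2^n$ complex matrix $\rho$, define its characteristic function and its Wigner function by $$\chi_\rho(x)=\operatorname{Tr}(W(x)^*\rho),\qquad \mathcal W_\rho(x)=2^{-n}\sum_{y\in G}\chi_\rho(y)\,\overline{\Phi(x)(y)},\qquad x\in G.$$ Let $\omega$ be the linear bijection from the $2^n\times 2^n$ complex matrices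 onto the complex Grassmann algebra generated by $\theta_1,\dots,\theta_{2n}$ with $\omega(c_{j_1}\cdots c_{j_m})=\theta_{j_1}\cdots\theta_{j_m}$ for $j_1<\cdots<j_m$. A matrix $\rho$ is an $n$-mode fermionic Gaussian state if $$\omega(\rho)=2^{-n}\exp\left(\tfrac i2\sum_{j,k}M_{jk}\theta_j\theta_k\right)$$ for some real antisymmetric $2n\times 2n$ matrix $M$ with $M^TM\le I$. **Theorem.** The maximally mixed state $2^{-n}I$ (which is positive semidefinite of trace one) is the only $n$-mode fermionic Gaussian state whose Wigner function is non-negative: a $2^n\times 2^n$ complex matrix $\rho$ is a fermionic Gaussian state such that $\mathcal W_\rho(x)$ is a non-negative real number for all $x\in G$ if and only if $\rho=2^{-n}I$. -/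

import Mathlib

namespace FermionicWigner

open scoped Matrix

/-- Operators on the `n`-mode space `ℓ²(ℤ₂ⁿ) = (ℂ²)^{⊗ n}`, in the standard basis. -/
abbrev Op (n : ℕ) : Type := Matrix (Fin n → Fin 2) (Fin n → Fin 2) ℂ

/-- The phase space `ℤ₂^{2n}`. -/
abbrev PhaseSpace (n : ℕ) : Type := Fin (2 * n) → ZMod 2

/-- The Pauli matrix `X`. -/
def pauliX : Matrix (Fin 2) (Fin 2) ℂ := !![0, 1; 1, 0]

/-- The Pauli matrix `Y`. -/
def pauliY : Matrix (Fin 2) (Fin 2) ℂ := !![0, -Complex.I; Complex.I, 0]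

/-- The Pauli matrix `Z`. -/
def pauliZ : Matrix (Fin 2) (Fin 2) ℂ := !![1, 0; 0, -1]

/-- The tensor product `A₁ ⊗ ⋯ ⊗ Aₙ` of `2 × 2` matrices. -/
def tensor {n : ℕ} (A : Fin n → Matrix (Fin 2) (Fin 2) ℂ) : Op n :=
  Matrix.of fun a b => ∏ j, A j (a j) (b j)

/-- The `j`-th tensor factor of the `k`-th Majorana operator (indices from `0`): `Z` before
mode `k / 2`, then `X` (even `k`) or `Y` (odd `k`) at mode `k / 2`, then identities. -/
def majoranaFactor (k j : ℕ) : Matrix (Fin 2) (Fin 2) ℂ :=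
  if j < k / 2 then pauliZ
  else if j = k / 2 then (if k % 2 = 0 then pauliX else pauliY)
  else 1

/-- The Majorana operators in the Jordan-Wigner form. With indices from `0`,
`majorana 2j = Z ⊗ ⋯ ⊗ Z ⊗ X ⊗ I ⊗ ⋯ ⊗ I` and `majorana (2j+1) = Z ⊗ ⋯ ⊗ Z ⊗ Y ⊗ I ⊗ ⋯ ⊗ I`,
with `X`, `Y` at the `j`-th tensor component. -/
def majorana {n : ℕ} (k : Fin (2 * n)) : Op n :=
  tensor fun j : Fin n => majoranaFactor k j

/-- The Weyl operators `W(x) = c₁^{x₁} ⋯ c_{2n}^{x_{2n}}` (ordered product). -/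
def weyl {n : ℕ} (x : PhaseSpace n) : Op n :=
  (List.ofFn fun k => majorana k ^ (x k).val).prod

/-- The strictly lower triangular all-ones matrix `Δ`. -/
def Delta (n : ℕ) : Matrix (Fin (2 * n)) (Fin (2 * n)) (ZMod 2) :=
  Matrix.of fun i j => if j < i then 1 else 0

/-- The (unnormalized) fermionic 2-cocycle `σ(x, y) = (-1)^{xᵀ Δ y}`. -/
def sigmaFer {n : ℕ} (x y : PhaseSpace n) : ℂ :=
  (-1) ^ (x ⬝ᵥ (Delta n *ᵥ y)).val

/-- The symplectic self-duality `Φ(x)(y) = σ(x, y) * conj σ(y, x)`. -/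
def Phi {n : ℕ} (x y : PhaseSpace n) : ℂ :=
  sigmaFer x y * star (sigmaFer y x)

/-- The characteristic function `χ_ρ(x) = Tr(W(x)^* ρ)`. -/
def charFn {n : ℕ} (ρ : Op n) (x : PhaseSpace n) : ℂ :=
  ((weyl x)ᴴ * ρ).trace

/-- The Wigner function: the symplectic Fourier transform of the characteristic function with
respect to the Haar measure `μ(A) = |A| / 2ⁿ` on `ℤ₂^{2n}`. -/
noncomputable def wigner {n : ℕ} (ρ : Op n) (x : PhaseSpace n) : ℂ :=
  ((2 : ℂ) ^ n)⁻¹ * ∑ y, charFn ρ y * star (Phi x y)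

open scoped ComplexOrder in
/-- `W_ρ ≥ 0`: every value of the Wigner function is a non-negative real number. -/
def WignerNonneg {n : ℕ} (ρ : Op n) : Prop :=
  ∀ x, 0 ≤ wigner ρ x

open scoped ComplexOrder in
/-- An `n`-mode fermionic state: a positive semidefinite operator of trace one. -/
def IsFermionicState {n : ℕ} (ρ : Op n) : Prop :=
  ρ.PosSemidef ∧ ρ.trace = 1

/-- The maximally mixed state `2⁻ⁿ I`. -/
noncomputable def maximallyMixed (n : ℕ) : Op n :=
  ((2 : ℂ) ^ n)⁻¹ • (1 : Op n)

/-! ### The monomials in the Majorana operators form a basis -/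

theorem tensor_mul {n : ℕ} (A B : Fin n → Matrix (Fin 2) (Fin 2) ℂ) :
    tensor A * tensor B = tensor fun j => A j * B j := by
  ext a b
  simp only [tensor, Matrix.mul_apply, Matrix.of_apply, ← Finset.prod_mul_distrib]
  rw [Finset.prod_univ_sum, Fintype.piFinset_univ]

theorem tensor_smul {n : ℕ} (e : Fin n → ℂ) (A : Fin n → Matrix (Fin 2) (Fin 2) ℂ) :
    (tensor fun j => e j • A j) = (∏ j, e j) • tensor A := by
  ext a b
  simp [tensor, Finset.prod_mul_distrib]

theorem tensor_one {n : ℕ} : tensor (fun _ : Fin n => 1) = 1 := by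
  ext a b
  by_cases h : a = b
  · subst h; simp [tensor]
  · obtain ⟨j, hj⟩ := Function.ne_iff.mp h
    rw [Matrix.one_apply_ne h]
    exact Finset.prod_eq_zero (Finset.mem_univ j) (Matrix.one_apply_ne hj)

theorem tensor_conjTranspose {n : ℕ} (A : Fin n → Matrix (Fin 2) (Fin 2) ℂ) :
    (tensor A)ᴴ = tensor fun j => (A j)ᴴ := by
  ext a b
  simp [tensor, Matrix.conjTranspose_apply]

theorem majoranaFactor_sq (k j : ℕ) : majoranaFactor k j * majoranaFactor k j = 1 := by
  unfold majoranaFactor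
  split_ifs <;> ext a b <;> fin_cases a <;> fin_cases b <;>
    simp [pauliX, pauliY, pauliZ, Matrix.mul_apply]

theorem majoranaFactor_herm (k j : ℕ) : (majoranaFactor k j)ᴴ = majoranaFactor k j := by
  unfold majoranaFactor
  split_ifs <;> ext a b <;> fin_cases a <;> fin_cases b <;>
    simp [pauliX, pauliY, pauliZ, Matrix.conjTranspose_apply]

theorem majoranaFactor_comm (k l : ℕ) (h : k ≠ l) (j : ℕ) :
    majoranaFactor k j * majoranaFactor l j =
      (if j = min (k / 2) (l / 2) then (-1 : ℂ) else 1) •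
        (majoranaFactor l j * majoranaFactor k j) := by
  unfold majoranaFactor
  split_ifs <;> first
    | omega
    | (ext a b; fin_cases a <;> fin_cases b <;>
        simp [pauliX, pauliY, pauliZ, Matrix.mul_apply])

theorem majorana_sq {n : ℕ} (k : Fin (2 * n)) : majorana k * majorana k = 1 := by
  simp only [majorana, tensor_mul, majoranaFactor_sq, tensor_one]

theorem majorana_herm {n : ℕ} (k : Fin (2 * n)) : (majorana k)ᴴ = majorana k := by
  simp only [majorana, tensor_conjTranspose, majoranaFactor_herm]

theorem majorana_anticomm {n : ℕ} (k l : Fin (2 * n)) (h : k ≠ l) :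
    majorana k * majorana l = (-1 : ℂ) • (majorana l * majorana k) := by
  have h' : (k : ℕ) ≠ l := fun e => h (Fin.ext e)
  simp only [majorana, tensor_mul]
  rw [show (fun j : Fin n => majoranaFactor k j * majoranaFactor l j) = fun j : Fin n =>
    (if (j : ℕ) = min ((k : ℕ) / 2) ((l : ℕ) / 2) then (-1 : ℂ) else 1) •
        (majoranaFactor l j * majoranaFactor k j) from
      funext fun j => majoranaFactor_comm k l h' j, tensor_smul]
  congr 1
  rw [Finset.prod_eq_single (⟨min ((k : ℕ) / 2) ((l : ℕ) / 2), by omega⟩ : Fin n)]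
  · simp
  · intro b _ hb
    exact if_neg fun e => hb (Fin.ext e)
  · simp

theorem mul_ofFn_prod {R : Type*} [Ring R] [Algebra ℂ R] (c : R) :
    ∀ (m : ℕ) (f : Fin m → R) (t : Fin m → ℂ), (∀ k, c * f k = t k • (f k * c)) →
      c * (List.ofFn f).prod = (∏ k, t k) • ((List.ofFn f).prod * c)
  | 0, f, t, _ => by simp
  | m + 1, f, t, h => by
    have ih := mul_ofFn_prod c m (fun k => f k.succ) (fun k => t k.succ) fun k => h k.succ
    rw [List.ofFn_succ, List.prod_cons, Fin.prod_univ_succ, ← mul_assoc, h 0, smul_mul_assoc,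
      mul_assoc, ih, mul_smul_comm, smul_smul, mul_assoc]

theorem ofFn_prod_unitary {n : ℕ} :
    ∀ (m : ℕ) (f : Fin m → Op n), (∀ k, (f k)ᴴ * f k = 1) →
      ((List.ofFn f).prod)ᴴ * (List.ofFn f).prod = 1
  | 0, f, _ => by simp
  | m + 1, f, h => by
    have ih := ofFn_prod_unitary m (fun k => f k.succ) fun k => h k.succ
    rw [List.ofFn_succ, List.prod_cons, Matrix.conjTranspose_mul, mul_assoc,
      ← mul_assoc (f 0)ᴴ, h 0, one_mul, ih]

/-- The sign by which `majorana k` commutes past `weyl x`. -/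
def commSign {n : ℕ} (k : Fin (2 * n)) (x : PhaseSpace n) : ℂ :=
  ∏ l, if l = k then 1 else (-1) ^ (x l).val

theorem majorana_mul_weyl {n : ℕ} (k : Fin (2 * n)) (x : PhaseSpace n) :
    majorana k * weyl x = commSign k x • (weyl x * majorana k) := by
  refine mul_ofFn_prod _ _ _ _ fun l => ?_
  by_cases h : l = k
  · subst h
    rw [if_pos rfl, one_smul, ← pow_succ, ← pow_succ']
  · rw [if_neg h]
    have hx : (x l).val = 0 ∨ (x l).val = 1 := by have := (x l).val_lt; omega
    rcases hx with hx | hx <;> rw [hx]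
    · simp
    · rw [pow_one, pow_one]; exact majorana_anticomm k l (Ne.symm h)

theorem weyl_unitary {n : ℕ} (x : PhaseSpace n) : (weyl x)ᴴ * weyl x = 1 := by
  refine ofFn_prod_unitary _ _ fun k => ?_
  have hx : (x k).val = 0 ∨ (x k).val = 1 := by have := (x k).val_lt; omega
  rcases hx with hx | hx <;> rw [hx]
  · simp
  · rw [pow_one, majorana_herm, majorana_sq]

theorem neg_one_pow_val_add (a b : ZMod 2) :
    (-1 : ℂ) ^ a.val * (-1) ^ b.val = (-1) ^ (a + b).val := by
  rw [← pow_add, ZMod.val_add]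
  exact (neg_one_pow_eq_pow_mod_two _).trans (by simp [neg_one_pow_eq_pow_mod_two])

theorem commSign_eq {n : ℕ} (k : Fin (2 * n)) (x : PhaseSpace n) :
    commSign k x = (-1) ^ (∑ l, x l - x k).val := by
  have key : ∀ s : Finset (Fin (2 * n)),
      (∏ l ∈ s, (-1 : ℂ) ^ (x l).val) = (-1) ^ (∑ l ∈ s, x l).val := by
    intro s
    induction s using Finset.induction_on with
    | empty => simp
    | insert a s ha ih => rw [Finset.prod_insert ha, Finset.sum_insert ha, ih, neg_one_pow_val_add]
  rw [← Finset.add_sum_erase _ _ (Finset.mem_univ k), add_sub_cancel_left, ← key, commSign,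
    ← Finset.mul_prod_erase _ _ (Finset.mem_univ k), if_pos rfl, one_mul]
  exact Finset.prod_congr rfl fun l hl => if_neg (Finset.ne_of_mem_erase hl)

theorem exists_commSign_ne {n : ℕ} {x y : PhaseSpace n} (h : x ≠ y) :
    ∃ k : Fin (2 * n), commSign k x * commSign k y = -1 := by
  by_contra hc
  push Not at hc
  have h1 : ∀ k, x k + y k = ∑ l, (x l + y l) := by
    intro k
    have hk := hc k
    rw [commSign_eq, commSign_eq, neg_one_pow_val_add] at hk
    set z := ∑ l, x l - x k + (∑ l, y l - y k) with hz
    have hz0 : z = 0 := by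
      by_contra hne
      have : z = 1 := by revert hne; generalize z = w; revert w; decide
      rw [this] at hk
      exact hk (by simp [ZMod.val_one])
    rw [Finset.sum_add_distrib]
    linear_combination -(hz.symm.trans hz0)
  apply h
  have h2 : ∑ l, (x l + y l) = 0 := by
    generalize hs : ∑ l, (x l + y l) = s at h1
    rw [← hs, Finset.sum_congr rfl fun l _ => h1 l]
    simp only [Finset.sum_const, Finset.card_univ, Fintype.card_fin, nsmul_eq_mul]
    push_cast
    rw [show (2 : ZMod 2) = 0 from rfl]; ring
  funext k
  have h3 := h1 k
  rw [h2] at h3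
  exact (CharTwo.add_eq_zero).mp h3

theorem trace_weyl_weyl {n : ℕ} {x y : PhaseSpace n} (h : x ≠ y) :
    ((weyl x)ᴴ * weyl y).trace = 0 := by
  obtain ⟨k, hk⟩ := exists_commSign_ne h
  have hx : (weyl x)ᴴ * majorana k = commSign k x • (majorana k * (weyl x)ᴴ) := by
    have := congrArg Matrix.conjTranspose (majorana_mul_weyl k x)
    rw [Matrix.conjTranspose_smul, Matrix.conjTranspose_mul, Matrix.conjTranspose_mul,
      majorana_herm] at this
    rw [this, commSign_eq]
    simp
  have e : (weyl x)ᴴ * weyl y = (-1 : ℂ) • (majorana k * ((weyl x)ᴴ * weyl y) * majorana k) := by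
    calc (weyl x)ᴴ * weyl y = (weyl x)ᴴ * (majorana k * majorana k) * weyl y := by
          rw [majorana_sq, mul_one]
      _ = ((weyl x)ᴴ * majorana k) * (majorana k * weyl y) := by simp only [mul_assoc]
      _ = _ := by
          rw [hx, majorana_mul_weyl, smul_mul_smul_comm, hk]
          simp only [mul_assoc]
  have t := congrArg Matrix.trace e
  rw [Matrix.trace_smul, Matrix.trace_mul_comm (majorana k * _), ← mul_assoc, majorana_sq,
    one_mul, smul_eq_mul] at t
  linear_combination t / 2

theorem weyl_linearIndependent (n : ℕ) :
    LinearIndependent ℂ (weyl : PhaseSpace n → Op n) := by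
  rw [Fintype.linearIndependent_iff]
  intro g hg y
  have := congrArg (fun A => ((weyl y)ᴴ * A).trace) hg
  simp only [Finset.mul_sum, Matrix.trace_sum, mul_smul_comm, Matrix.trace_smul, mul_zero,
    Matrix.trace_zero] at this
  rw [Finset.sum_eq_single y (fun x _ hx => by rw [trace_weyl_weyl hx.symm, smul_zero])
    (by simp), weyl_unitary, Matrix.trace_one] at this
  simpa using this

/-- The basis of the operator space consisting of the monomials `c_{j₁} ⋯ c_{jₘ}`,
`j₁ < ⋯ < jₘ`. -/
noncomputable def weylBasis (n : ℕ) : Module.Basis (PhaseSpace n) ℂ (Op n) :=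
  basisOfLinearIndependentOfCardEqFinrank (weyl_linearIndependent n) (by
    simp [Module.finrank_matrix, pow_mul, ← mul_pow])

theorem weylBasis_apply {n : ℕ} (x : PhaseSpace n) : weylBasis n x = weyl x := by
  simp [weylBasis]

/-! ### Grassmann representation and Gaussian states -/

/-- The Grassmann algebra on the `2n` generators `θ₁, …, θ_{2n}`. -/
abbrev Grassmann (n : ℕ) : Type := ExteriorAlgebra ℂ (Fin (2 * n) → ℂ)

/-- The Grassmann generators. -/
noncomputable def theta {n : ℕ} (j : Fin (2 * n)) : Grassmann n :=
  ExteriorAlgebra.ι ℂ (Pi.single j 1)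

/-- The ordered monomial `θ₁^{x₁} ⋯ θ_{2n}^{x_{2n}}`. -/
noncomputable def thetaMonomial {n : ℕ} (x : PhaseSpace n) : Grassmann n :=
  (List.ofFn fun k => theta k ^ (x k).val).prod

/-- The Grassmann representation: the linear map with
`c_{j₁} ⋯ c_{jₘ} ↦ θ_{j₁} ⋯ θ_{jₘ}` for `j₁ < ⋯ < jₘ`. -/
noncomputable def grassmannRep (n : ℕ) : Op n →ₗ[ℂ] Grassmann n :=
  (weylBasis n).constr ℂ thetaMonomial

theorem grassmannRep_weyl {n : ℕ} (x : PhaseSpace n) :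
    grassmannRep n (weyl x) = thetaMonomial x := by
  rw [grassmannRep, ← weylBasis_apply, Module.Basis.constr_basis]

/-- The quadratic form `(i/2) θᵀ M θ` in the Grassmann variables. -/
noncomputable def grassmannQuadratic {n : ℕ} (M : Matrix (Fin (2 * n)) (Fin (2 * n)) ℝ) :
    Grassmann n :=
  (Complex.I / 2) • ∑ j, ∑ k, (M j k : ℂ) • (theta j * theta k)

/-- The quadratic form is nilpotent, so that its exponential is a genuine one. -/
theorem grassmannQuadratic_pow {n : ℕ} (M : Matrix (Fin (2 * n)) (Fin (2 * n)) ℝ) :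
    grassmannQuadratic M ^ (n + 1) = 0 := by
  have h2 : grassmannQuadratic M ∈ ⋀[ℂ]^2 (Fin (2 * n) → ℂ) := by
    refine Submodule.smul_mem _ _ (Submodule.sum_mem _ fun j _ => Submodule.sum_mem _ fun k _ =>
      Submodule.smul_mem _ _ ?_)
    rw [ExteriorAlgebra.exteriorPower, pow_two]
    exact Submodule.mul_mem_mul ⟨_, rfl⟩ ⟨_, rfl⟩
  have h3 : grassmannQuadratic M ^ (n + 1) ∈ ⋀[ℂ]^(2 * (n + 1)) (Fin (2 * n) → ℂ) := by
    rw [ExteriorAlgebra.exteriorPower, pow_mul]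
    exact Submodule.pow_mem_pow _ h2 _
  have h4 : ⋀[ℂ]^(2 * (n + 1)) (Fin (2 * n) → ℂ) = ⊥ := by
    rw [← Submodule.finrank_eq_zero, exteriorPower.finrank_eq, Module.finrank_fin_fun]
    exact Nat.choose_eq_zero_of_lt (by omega)
  rw [h4] at h3
  exact (Submodule.mem_bot ℂ).mp h3

/-- A fermionic Gaussian state: `ω(ρ) = 2⁻ⁿ exp((i/2) θᵀ M θ)` for a real antisymmetric matrix
`M` with `Mᵀ M ≤ I`. The exponential is that of a nilpotent element (a finite sum). -/
def IsFermionicGaussian {n : ℕ} (ρ : Op n) : Prop :=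
  ∃ M : Matrix (Fin (2 * n)) (Fin (2 * n)) ℝ, M = -Mᵀ ∧ (1 - Mᵀ * M).PosSemidef ∧
    grassmannRep n ρ = ((2 : ℂ) ^ n)⁻¹ • IsNilpotent.exp (grassmannQuadratic M)

end FermionicWigner

namespace FermionicWigner

open CliffordAlgebra ExteriorAlgebra
open scoped Matrix

/-! ### Symplectic Fourier inversion -/

/-! Reality of the Wigner function alone forces a Gaussian state to be maximally mixed. The kernel
`Phi` takes only the values ±1, so inverting the Fourier transform (`charFn_eq_sum_wigner`) shows
that the characteristic function is real. Up to the factor `2 ^ n` its values are the coefficients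
of `ρ` in the Majorana monomials (`charFn_eq_repr`), hence also those of its Grassmann
representation. But a Gaussian state has `θ_j θ_k` coefficient `2⁻ⁿ i M j k` (`quadCoeff_exp`),
which is imaginary. So `M = 0`, and injectivity of the representation (`grassmannRep_injective`)
identifies `ρ`. -/

theorem sigmaFer_add_left {n : ℕ} (x x' y : PhaseSpace n) :
    sigmaFer (x + x') y = sigmaFer x y * sigmaFer x' y := by
  simp only [sigmaFer, add_dotProduct, neg_one_pow_val_add]

theorem sigmaFer_add_right {n : ℕ} (x y y' : PhaseSpace n) :
    sigmaFer x (y + y') = sigmaFer x y * sigmaFer x y' := by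
  simp only [sigmaFer, Matrix.mulVec_add, dotProduct_add, neg_one_pow_val_add]

theorem star_sigmaFer {n : ℕ} (x y : PhaseSpace n) : star (sigmaFer x y) = sigmaFer x y := by
  simp [sigmaFer]

theorem sigmaFer_mul_self {n : ℕ} (x y : PhaseSpace n) : sigmaFer x y * sigmaFer x y = 1 := by
  rw [sigmaFer, ← mul_pow]
  simp

theorem star_Phi {n : ℕ} (x y : PhaseSpace n) : star (Phi x y) = Phi x y := by
  simp only [Phi, star_mul', star_sigmaFer]

theorem Phi_mul_self {n : ℕ} (x y : PhaseSpace n) : Phi x y * Phi x y = 1 := by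
  rw [Phi, star_sigmaFer, mul_mul_mul_comm, sigmaFer_mul_self, sigmaFer_mul_self, one_mul]

theorem Phi_zero_right {n : ℕ} (x : PhaseSpace n) : Phi x 0 = 1 := by
  simp [Phi, sigmaFer]

theorem Phi_add_left {n : ℕ} (x x' y : PhaseSpace n) :
    Phi (x + x') y = Phi x y * Phi x' y := by
  simp only [Phi, sigmaFer_add_left, sigmaFer_add_right, star_mul']
  ring

/-- For `l ≠ k` exactly one of the `(k, l)` and `(l, k)` entries of `Delta` is 1, and the diagonal
vanishes, so the exponent is the sum of all `y l` with `l ≠ k`. This makes `exists_commSign_ne`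
available as nondegeneracy of `Phi`. -/
theorem Phi_single {n : ℕ} (k : Fin (2 * n)) (y : PhaseSpace n) :
    Phi (Pi.single k 1) y = commSign k y := by
  rw [Phi, star_sigmaFer, sigmaFer, sigmaFer, neg_one_pow_val_add, commSign_eq]
  congr 2
  rw [single_one_dotProduct, Matrix.mulVec_single_one, Matrix.mulVec, dotProduct, dotProduct,
    ← Finset.sum_add_distrib, ← Finset.add_sum_erase _ y (Finset.mem_univ k), add_sub_cancel_left,
    ← Finset.add_sum_erase _ _ (Finset.mem_univ k)]
  simp only [Delta, Matrix.of_apply, Matrix.col_apply, lt_irrefl, if_false, zero_mul, mul_zero,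
    add_zero, zero_add]
  refine Finset.sum_congr rfl fun l hl => ?_
  rcases lt_or_gt_of_ne (Finset.ne_of_mem_erase hl) with h | h
  · simp [h, h.not_gt]
  · simp [h, h.not_gt]

/-- Orthogonality of characters: if `y ≠ z`, translating the summation variable by a suitable unit
vector changes the sign of the sum. -/
theorem sum_Phi_mul_Phi {n : ℕ} (y z : PhaseSpace n) :
    ∑ x, Phi x y * Phi x z = if y = z then (2 : ℂ) ^ (2 * n) else 0 := by
  split_ifs with h
  · subst h
    simp [Phi_mul_self]
  · obtain ⟨k, hk⟩ := exists_commSign_ne h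
    have e := Equiv.sum_comp (Equiv.addRight (Pi.single k 1 : PhaseSpace n))
      fun x => Phi x y * Phi x z
    simp only [Equiv.coe_addRight, Phi_add_left, Phi_single, mul_mul_mul_comm _ (commSign k y),
      hk, ← Finset.sum_mul] at e
    linear_combination -e / 2

/-- Inversion of the symplectic Fourier transform. -/
theorem charFn_eq_sum_wigner {n : ℕ} (ρ : Op n) (z : PhaseSpace n) :
    charFn ρ z = ((2 : ℂ) ^ n)⁻¹ * ∑ x, wigner ρ x * Phi x z := by
  have h : ∑ x, wigner ρ x * Phi x z =
      ((2 : ℂ) ^ n)⁻¹ * ∑ y, charFn ρ y * ∑ x, Phi x y * Phi x z := by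
    simp only [wigner, star_Phi, Finset.mul_sum, Finset.sum_mul]
    rw [Finset.sum_comm]
    simp only [mul_assoc]
  rw [h]
  simp only [sum_Phi_mul_Phi, mul_ite, mul_zero, Finset.sum_ite_eq', Finset.mem_univ, if_true]
  field_simp
  ring

theorem charFn_im_eq_zero {n : ℕ} {ρ : Op n} (h : ∀ x, (wigner ρ x).im = 0)
    (z : PhaseSpace n) : (charFn ρ z).im = 0 := by
  rw [← Complex.conj_eq_iff_im, charFn_eq_sum_wigner]
  simp only [map_mul, map_inv₀, map_pow, map_sum, Complex.conj_ofNat]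
  congr 1
  refine Finset.sum_congr rfl fun x _ => ?_
  rw [Complex.conj_eq_iff_im.2 (h x)]
  exact congrArg _ (star_Phi x z)

/-- The Weyl operators are orthogonal for the trace form, each of squared norm `2 ^ n`. -/
theorem charFn_eq_repr {n : ℕ} (ρ : Op n) (z : PhaseSpace n) :
    charFn ρ z = (2 : ℂ) ^ n * (weylBasis n).repr ρ z := by
  conv_lhs => rw [← (weylBasis n).sum_repr ρ]
  simp only [charFn, weylBasis_apply, Finset.mul_sum, Matrix.trace_sum, mul_smul_comm,
    Matrix.trace_smul]
  rw [Finset.sum_eq_single z (fun x _ hx => by rw [trace_weyl_weyl hx.symm, smul_zero])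
    (by simp), weyl_unitary, Matrix.trace_one, smul_eq_mul, mul_comm]
  simp

theorem repr_im_eq_zero {n : ℕ} {ρ : Op n} (h : ∀ x, (wigner ρ x).im = 0)
    (z : PhaseSpace n) : ((weylBasis n).repr ρ z).im = 0 := by
  have e : (weylBasis n).repr ρ z = (((2 : ℝ) ^ n)⁻¹ : ℝ) * charFn ρ z := by
    rw [charFn_eq_repr]
    push_cast
    field_simp
  rw [e, Complex.im_ofReal_mul, charFn_im_eq_zero h, mul_zero]

/-! ### Grassmann derivatives -/

/-- The left derivative with respect to the `k`-th Grassmann generator. -/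
noncomputable def thetaDeriv {n : ℕ} (k : Fin (2 * n)) : Grassmann n →ₗ[ℂ] Grassmann n :=
  contractLeft (LinearMap.proj k)

/-- The degree zero part of an element of the Grassmann algebra. -/
noncomputable def grassmannScalar (n : ℕ) : Grassmann n →ₐ[ℂ] ℂ :=
  ExteriorAlgebra.algebraMapInv

theorem thetaDeriv_theta_mul {n : ℕ} (k a : Fin (2 * n)) (z : Grassmann n) :
    thetaDeriv k (theta a * z) = (if k = a then z else 0) - theta a * thetaDeriv k z := by
  rw [thetaDeriv, theta, ExteriorAlgebra.ι, contractLeft_ι_mul, LinearMap.proj_apply,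
    Pi.single_apply, ite_smul, one_smul, zero_smul]

theorem thetaDeriv_one {n : ℕ} (k : Fin (2 * n)) : thetaDeriv k (1 : Grassmann n) = 0 := by
  rw [thetaDeriv, contractLeft_one]

theorem grassmannScalar_theta {n : ℕ} (a : Fin (2 * n)) : grassmannScalar n (theta a) = 0 := by
  simp [grassmannScalar, theta, ExteriorAlgebra.algebraMapInv]

theorem pow_zmod_two_val {M : Type*} [Monoid M] (a : M) (t : ZMod 2) :
    a ^ t.val = if t = 0 then 1 else a := by
  split_ifs with h
  · rw [h, ZMod.val_zero, pow_zero]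
  · rw [show t = 1 by revert t; decide, ZMod.val_one, pow_one]

/-! ### Linear independence of the Grassmann monomials -/

theorem thetaDeriv_prod_ofFn_eq_zero {n : ℕ} (k : Fin (2 * n)) :
    ∀ (m : ℕ) (f : Fin m → Fin (2 * n)) (x : Fin m → ZMod 2), (∀ i, f i ≠ k) →
      thetaDeriv k (List.ofFn fun i => (theta (f i) : Grassmann n) ^ (x i).val).prod = 0
  | 0, f, x, _ => by simp [thetaDeriv_one]
  | m + 1, f, x, h => by
    have ih := thetaDeriv_prod_ofFn_eq_zero k m (fun i => f i.succ) (fun i => x i.succ)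
      fun i => h i.succ
    rw [List.ofFn_succ, List.prod_cons, pow_zmod_two_val]
    split_ifs
    · rw [one_mul, ih]
    · rw [thetaDeriv_theta_mul, ih, if_neg (h 0).symm, mul_zero, sub_zero]

/-- Dual functionals to the monomials, built by induction on the number of generators; an arbitrary
injection `f` lets the tail have the same form. If `y 0 = 0`, the functional of the tail still
works, because by the second clause it kills every monomial that starts with `theta (f 0)`.
Otherwise it is composed with the derivative along `f 0`, which strips that generator and kills the
monomials without it. -/
theorem exists_dual_prod_ofFn {n : ℕ} :
    ∀ (m : ℕ) (f : Fin m → Fin (2 * n)), Function.Injective f → ∀ y : Fin m → ZMod 2,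
      ∃ φ : Grassmann n →ₗ[ℂ] ℂ,
        (∀ x : Fin m → ZMod 2,
          φ (List.ofFn fun i => (theta (f i) : Grassmann n) ^ (x i).val).prod =
            if x = y then 1 else 0) ∧
        ∀ a, (∀ i, f i ≠ a) → ∀ z, φ (theta a * z) = 0
  | 0, f, _, y => by
    refine ⟨(grassmannScalar n).toLinearMap, fun x => ?_, fun a _ z => ?_⟩
    · simp [Subsingleton.elim x y]
    · simp [grassmannScalar_theta]
  | m + 1, f, hf, y => by
    obtain ⟨φ, h1, h2⟩ := exists_dual_prod_ofFn m (fun i => f i.succ)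
      (hf.comp (Fin.succ_injective m)) fun i => y i.succ
    have hne : ∀ i : Fin m, f i.succ ≠ f 0 := fun i h => Fin.succ_ne_zero i (hf h)
    have hxy : ∀ x : Fin (m + 1) → ZMod 2,
        x = y ↔ x 0 = y 0 ∧ (fun i : Fin m => x i.succ) = fun i => y i.succ := by
      intro x
      rw [funext_iff, Fin.forall_fin_succ, funext_iff]
    by_cases hy : y 0 = 0
    · refine ⟨φ, fun x => ?_, fun a ha z => h2 a (fun i => ha i.succ) z⟩
      rw [List.ofFn_succ, List.prod_cons, pow_zmod_two_val]
      simp only [hxy x, hy]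
      by_cases hx : x 0 = 0
      · simp only [hx, if_true, one_mul, true_and]
        exact h1 _
      · simp only [hx, if_false, false_and]
        exact h2 _ hne _
    · refine ⟨φ ∘ₗ thetaDeriv (f 0), fun x => ?_, fun a ha z => ?_⟩
      · rw [List.ofFn_succ, List.prod_cons, pow_zmod_two_val, LinearMap.comp_apply]
        simp only [hxy x]
        by_cases hx : x 0 = 0
        · rw [if_pos hx, one_mul, thetaDeriv_prod_ofFn_eq_zero _ _ _ _ hne, map_zero,
            if_neg fun h => hy (h.1.symm.trans hx)]
        · have h0 : x 0 = y 0 := by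
            revert hx hy
            generalize x 0 = s
            generalize y 0 = t
            revert s t
            decide
          rw [if_neg hx, thetaDeriv_theta_mul, thetaDeriv_prod_ofFn_eq_zero _ _ _ _ hne,
            if_pos rfl, mul_zero, sub_zero, h1]
          simp only [h0, true_and]
      · rw [LinearMap.comp_apply, thetaDeriv_theta_mul, if_neg (ha 0), zero_sub, map_neg,
          h2 a (fun i => ha i.succ), neg_zero]

theorem thetaMonomial_linearIndependent (n : ℕ) :
    LinearIndependent ℂ (thetaMonomial : PhaseSpace n → Grassmann n) := by
  rw [Fintype.linearIndependent_iff]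
  intro g hg y
  obtain ⟨φ, hφ, -⟩ := exists_dual_prod_ofFn (2 * n) id Function.injective_id y
  have h := congrArg φ hg
  have hφ' : ∀ x : PhaseSpace n, φ (thetaMonomial x) = if x = y then 1 else 0 := hφ
  simpa [hφ'] using h

theorem grassmannRep_apply {n : ℕ} (ρ : Op n) :
    grassmannRep n ρ = ∑ x, (weylBasis n).repr ρ x • thetaMonomial x := by
  rw [grassmannRep, Module.Basis.constr_apply_fintype]
  rfl

theorem grassmannRep_injective (n : ℕ) : Function.Injective (grassmannRep n) := by
  rw [injective_iff_map_eq_zero]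
  intro ρ h
  rw [grassmannRep_apply] at h
  have := Fintype.linearIndependent_iff.1 (thetaMonomial_linearIndependent n) _ h
  exact (weylBasis n).ext_elem fun x => by simp [this x]

theorem weyl_zero (n : ℕ) : weyl (0 : PhaseSpace n) = 1 := by
  simp [weyl]

theorem grassmannRep_one (n : ℕ) : grassmannRep n 1 = 1 := by
  rw [← weyl_zero, grassmannRep_weyl]
  simp [thetaMonomial]

/-! ### Quadratic coefficients -/

/-- The coefficient functional of `θ_j θ_k` (for `j ≠ k`). -/
noncomputable def quadCoeff {n : ℕ} (j k : Fin (2 * n)) : Grassmann n →ₗ[ℂ] ℂ :=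
  (grassmannScalar n).toLinearMap ∘ₗ thetaDeriv k ∘ₗ thetaDeriv j

theorem quadCoeff_one {n : ℕ} (j k : Fin (2 * n)) : quadCoeff j k 1 = 0 := by
  simp [quadCoeff, thetaDeriv_one]

/-- Both derivatives must hit the two leading generators; every other term keeps a generator in
front and has no scalar part. -/
theorem quadCoeff_theta_mul_theta_mul {n : ℕ} (j k a b : Fin (2 * n)) (z : Grassmann n) :
    quadCoeff j k (theta a * theta b * z) =
      ((if j = a then if k = b then 1 else 0 else 0) -
        if k = a then if j = b then 1 else 0 else 0) * grassmannScalar n z := by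
  simp only [quadCoeff, LinearMap.comp_apply, mul_assoc, thetaDeriv_theta_mul, map_sub,
    AlgHom.toLinearMap_apply, map_mul, grassmannScalar_theta, zero_mul, sub_zero,
    apply_ite (thetaDeriv k), apply_ite (grassmannScalar n), map_zero]
  split_ifs <;> simp

theorem grassmannScalar_quadratic {n : ℕ} (M : Matrix (Fin (2 * n)) (Fin (2 * n)) ℝ) :
    grassmannScalar n (grassmannQuadratic M) = 0 := by
  simp only [grassmannQuadratic, map_smul, map_sum, map_mul, grassmannScalar_theta, zero_mul,
    smul_zero, Finset.sum_const_zero]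

/-- The two orderings contribute `(i/2) (M j k - M k j)`, which antisymmetry turns into `i M j k`.
-/
theorem quadCoeff_quadratic_mul {n : ℕ} {M : Matrix (Fin (2 * n)) (Fin (2 * n)) ℝ}
    (hM : M = -Mᵀ) (j k : Fin (2 * n)) (z : Grassmann n) :
    quadCoeff j k (grassmannQuadratic M * z) = Complex.I * M j k * grassmannScalar n z := by
  have hkj : M k j = -M j k := congrFun (congrFun hM k) j
  simp only [grassmannQuadratic, smul_mul_assoc, Finset.sum_mul, map_smul, map_sum,
    quadCoeff_theta_mul_theta_mul, smul_eq_mul, sub_mul, mul_sub, Finset.sum_sub_distrib]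
  simp [hkj]
  ring

theorem quadCoeff_exp {n : ℕ} {M : Matrix (Fin (2 * n)) (Fin (2 * n)) ℝ}
    (hM : M = -Mᵀ) (j k : Fin (2 * n)) :
    quadCoeff j k (IsNilpotent.exp (grassmannQuadratic M)) = Complex.I * M j k := by
  -- The exponent `n + 2` ensures that the terms of degree 0 and 1 can be split off even when `n =
  -- 0`.
  have h0 : grassmannQuadratic M ^ (n + 2) = 0 := by
    rw [pow_succ, grassmannQuadratic_pow, zero_mul]
  -- After one factor is absorbed by `quadCoeff`, the remaining power has zero scalar part.
  have hp : ∀ i : ℕ, quadCoeff j k (grassmannQuadratic M ^ (i + 2)) = 0 := fun i => by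
    rw [pow_succ', quadCoeff_quadratic_mul hM, map_pow, grassmannScalar_quadratic]
    simp
  have h1 : quadCoeff j k (grassmannQuadratic M) = Complex.I * M j k := by
    simpa using quadCoeff_quadratic_mul hM j k 1
  rw [IsNilpotent.exp_eq_sum h0, map_sum, Finset.sum_range_succ', Finset.sum_range_succ',
    Finset.sum_eq_zero fun i _ => by
      -- The exponential series has rational scalars; they are moved to ℂ so that ℂ-linearity
      -- applies.
      rw [← algebraMap_smul ℂ, map_smul, add_assoc, hp, smul_zero]]
  simp [quadCoeff_one, h1]

/-- Prepending a generator reduces each second derivative to first derivatives of the tail, and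
these to its scalar part, so the three claims are carried through one induction. The factors 1 stand
for zeroth powers. -/
theorem quadCoeff_prod_im {n : ℕ} (l : List (Grassmann n))
    (hl : ∀ a ∈ l, a = 1 ∨ ∃ k, a = theta k) (j k : Fin (2 * n)) :
    (grassmannScalar n l.prod).im = 0 ∧
      (∀ i, (grassmannScalar n (thetaDeriv i l.prod)).im = 0) ∧
      (quadCoeff j k l.prod).im = 0 := by
  induction l with
  | nil => simp [quadCoeff_one, thetaDeriv_one]
  | cons a l ih =>
    obtain ⟨h0, h1, h2⟩ := ih fun b hb => hl b (List.mem_cons_of_mem _ hb)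
    rw [List.prod_cons]
    rcases hl a List.mem_cons_self with rfl | ⟨b, rfl⟩
    · rw [one_mul]
      exact ⟨h0, h1, h2⟩
    · refine ⟨by simp [grassmannScalar_theta], fun i => ?_, ?_⟩
      · rw [thetaDeriv_theta_mul]
        split_ifs <;> simp [grassmannScalar_theta, h0]
      · simp only [quadCoeff, LinearMap.comp_apply, thetaDeriv_theta_mul, map_sub]
        split_ifs <;> simp [grassmannScalar_theta, h1]

theorem quadCoeff_thetaMonomial_im {n : ℕ} (j k : Fin (2 * n)) (x : PhaseSpace n) :
    (quadCoeff j k (thetaMonomial x)).im = 0 := by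
  refine (quadCoeff_prod_im _ (fun a ha => ?_) j k).2.2
  obtain ⟨i, rfl⟩ := (List.mem_ofFn' _ _).1 ha
  simp only [pow_zmod_two_val]
  split_ifs
  · exact Or.inl rfl
  · exact Or.inr ⟨i, rfl⟩

/-! ### Gaussian states with real Wigner function -/

theorem grassmannQuadratic_zero (n : ℕ) :
    grassmannQuadratic (0 : Matrix (Fin (2 * n)) (Fin (2 * n)) ℝ) = 0 := by
  simp [grassmannQuadratic]

theorem IsFermionicGaussian.eq_maximallyMixed {n : ℕ} {ρ : Op n} (hρ : IsFermionicGaussian ρ)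
    (hW : ∀ x, (wigner ρ x).im = 0) : ρ = maximallyMixed n := by
  obtain ⟨M, hM, -, hexp⟩ := hρ
  have hM0 : M = 0 := by
    ext j k
    -- The same coefficient is computed twice: real from the Weyl expansion, imaginary from the
    -- exponential.
    have h1 : (quadCoeff j k (grassmannRep n ρ)).im = 0 := by
      rw [grassmannRep_apply, map_sum, Complex.im_sum]
      refine Finset.sum_eq_zero fun x _ => ?_
      rw [map_smul, smul_eq_mul, Complex.mul_im, quadCoeff_thetaMonomial_im,
        repr_im_eq_zero hW, mul_zero, zero_mul, add_zero]
    have e : ((2 : ℂ) ^ n)⁻¹ = (((2 : ℝ) ^ n)⁻¹ : ℝ) := by push_cast; rfl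
    rw [hexp, map_smul, quadCoeff_exp hM, smul_eq_mul, e, Complex.im_ofReal_mul] at h1
    simpa using h1
  rw [hM0, grassmannQuadratic_zero, IsNilpotent.exp_zero, ← grassmannRep_one, ← map_smul] at hexp
  exact grassmannRep_injective n hexp

/-! ### The maximally mixed state -/

theorem isFermionicGaussian_maximallyMixed (n : ℕ) : IsFermionicGaussian (maximallyMixed n) := by
  refine ⟨0, by simp, by simpa using Matrix.PosSemidef.one, ?_⟩
  rw [grassmannQuadratic_zero, IsNilpotent.exp_zero, maximallyMixed, map_smul, grassmannRep_one]

/-- By orthogonality of the Weyl operators the characteristic function is the indicator of 0, whose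
Fourier transform is constant. -/
theorem wigner_maximallyMixed {n : ℕ} (x : PhaseSpace n) :
    wigner (maximallyMixed n) x = ((2 : ℂ) ^ n)⁻¹ := by
  have h : ∀ y : PhaseSpace n, charFn (maximallyMixed n) y = if y = 0 then 1 else 0 := by
    intro y
    rw [charFn, maximallyMixed, mul_smul_comm, Matrix.trace_smul, ← weyl_zero]
    split_ifs with hy
    · subst hy
      rw [weyl_unitary, Matrix.trace_one]
      simp
    · rw [trace_weyl_weyl hy, smul_zero]
  simp [wigner, h, Phi_zero_right]

open scoped ComplexOrder in
theorem wignerNonneg_maximallyMixed (n : ℕ) : WignerNonneg (maximallyMixed n) := by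
  intro x
  rw [wigner_maximallyMixed]
  positivity

open scoped ComplexOrder in
theorem isFermionicState_maximallyMixed (n : ℕ) : IsFermionicState (maximallyMixed n) := by
  refine ⟨Matrix.PosSemidef.one.smul (by positivity), ?_⟩
  rw [maximallyMixed, Matrix.trace_smul, Matrix.trace_one]
  simp

open scoped ComplexOrder in
theorem WignerNonneg.im_eq_zero {n : ℕ} {ρ : Op n} (h : WignerNonneg ρ) (x : PhaseSpace n) :
    (wigner ρ x).im = 0 :=
  (Complex.nonneg_iff.1 (h x)).2.symm

end FermionicWigner

theorem mainTheorem9 (n : ℕ) :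
    FermionicWigner.IsFermionicState (FermionicWigner.maximallyMixed n) ∧
    ∀ ρ : FermionicWigner.Op n,
      (FermionicWigner.IsFermionicGaussian ρ ∧ FermionicWigner.WignerNonneg ρ) ↔
        ρ = FermionicWigner.maximallyMixed n := by
  refine ⟨FermionicWigner.isFermionicState_maximallyMixed n, fun ρ => ⟨fun h => ?_, ?_⟩⟩
  · exact h.1.eq_maximallyMixed h.2.im_eq_zero
  · rintro rfl
    exact ⟨FermionicWigner.isFermionicGaussian_maximallyMixed n,
      FermionicWigner.wignerNonneg_maximallyMixed n⟩
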